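/- Let $m$ be the Lebesgue measure on the unit circle $\mathbb T$, normalized by $m(\mathbb T)=1$. For a finite positive Borel measure $\rho$ on $\mathbb T$ and $n\ge 0$ put $$e_n(\rho)=\min_{q_0,\dots,q_{n-1}\in\mathbb C}\Bigl(\int_{\mathbb T}\bigl|q_0+q_1t+\dots+q_{n-1}t^{n-1}+t^n\bigr|^2\,d\rho(t)\Bigr)^{1/2}.$$ For a measurable function $H\colon\mathbb T\to[0,+\infty]$ let $\lambda_H(a)=m\{H>a\}$, $a\ge0$, be its distribution function, and let $e^{-\infty}=0$. Theorem. For every $\kappa<1$ there is a constant $C>0$, depending only on $\kappa$, such that the following holds. Let $\rho$ be a finite positive Borel measure on $\mathbb T$ and let $H\colon\mathbb T\to[0,+\infty]$ be measurable with $\int_{\mathbb T}H\,dm=+\infty$ and $m\{H=+\infty\}\le\kappa$. Suppose that $d\rho\ge e^{-H}\,dm$. Then for all sufficiently large $n$ (how large may depend on $\rho$ and $H$) we have $e_n(\rho)>0$, and $$|\log e_n(\rho)|\le C\int_0^A\lambda_H(a)\,da$$ for every solution $A=A(n)$ of the equation $n\lambda_H(A)=A$. In particular (taking $\kappa=0$),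 $C$ is an absolute constant when $H<+\infty$ almost everywhere. -/

import Mathlib

open MeasureTheory Filter Set
open scoped ENNReal

namespace SzegoMinimum

noncomputable instance circleMeasurableSpace : MeasurableSpace Circle := borel Circle

instance circleBorelSpace : BorelSpace Circle := ⟨rfl⟩

/-- Normalized Lebesgue measure (arc length) on the unit circle: the image of
`dθ / (2π)` on `(-π, π]` under `θ ↦ exp (i θ)`. -/
noncomputable def m : Measure Circle :=
  ENNReal.ofReal (2 * Real.pi)⁻¹ •
    (volume.restrict (Ioc (-Real.pi) Real.pi)).map Circle.exp

instance isProbabilityMeasure_m : IsProbabilityMeasure m := by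
  refine ⟨?_⟩
  have h : (0 : ℝ) < 2 * Real.pi := by positivity
  rw [m, Measure.smul_apply,
    Measure.map_apply Circle.exp.continuous.measurable MeasurableSet.univ, preimage_univ,
    Measure.restrict_apply_univ, Real.volume_Ioc, smul_eq_mul,
    ← ENNReal.ofReal_mul (inv_nonneg.mpr h.le), sub_neg_eq_add, ← two_mul,
    inv_mul_cancel₀ h.ne', ENNReal.ofReal_one]

/-- `e_n(ρ)`: the least `L²(ρ)`-norm of a monic polynomial
`q₀ + q₁ t + ⋯ + q_{n-1} t^{n-1} + t^n` of degree `n`, i.e. the distance in `L²(ρ)` from `t^n`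
to the polynomials of degree less than `n`. -/
noncomputable def minNorm (ρ : Measure Circle) (n : ℕ) : ℝ :=
  ⨅ q : Fin n → ℂ,
    √(∫ t : Circle, ‖(∑ j : Fin n, q j * (t : ℂ) ^ (j : ℕ)) + (t : ℂ) ^ n‖ ^ 2 ∂ρ)

/-- The distribution function `λ_H(a) = m {H > a}`, for `a ≥ 0`. -/
noncomputable def distribFun (H : Circle → ℝ≥0∞) (a : ℝ) : ℝ :=
  m.real {t | ENNReal.ofReal a < H t}

/-- The measure `e^{-H} dm`, where `e^{-∞} = 0`. -/
noncomputable def expNegMeasure (H : Circle → ℝ≥0∞) : Measure Circle :=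
  m.withDensity fun t => EReal.exp (-(H t : EReal))

end SzegoMinimum

namespace SzegoMinimum

/-! The substance is a lower bound for `∫ |p|² dρ` over monic `p` of degree `n`. Let `E = {H > A}`
and `ε = m E`. Jensen's formula gives `∫ log |p| dm ≥ 0`, so the integral over `E` and the one over
its complement cannot both be very negative. Off `E`, concavity of the logarithm bounds `2 ∫ log
|p|` by `∫_{Eᶜ} H` plus a term that is very negative when `∫ |p|² dρ` is small. It remains to bound
`log |p|` above on the small set `E`.

That is a Remez-type estimate (`log_norm_eval_le_remezBound`). Off `E` the density is at least
`e^{-A}`, so `∫_{Eᶜ} |p|² dm ≤ e^A` may be assumed. By Poisson–Jensen, `|p|` on the circle is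
controlled by `n log R` plus a Poisson average of `log |p|`, whose kernel is at most `(R + 1) / (R -
1)`. Taking `R - 1` comparable to `ε` leaves `E` with harmonic measure bounded away from `1`, and
the bound closes on itself. It has order `nε + A + log (1/ε)`.

Multiplied by `ε`, with `nε = A`, this is of order `Aε + 1`. Both `Aε` and `∫_{Eᶜ} H` are at most `I
= ∫₀^A λ_H`. As `∫ H = ∞`, `I` tends to infinity with `n` and absorbs all constants, including the
upper bound from `q = 0`. -/

/-! ### Arc length on the circle and Jensen's inequality for monic polynomials. -/

theorem measurable_circle_coe : Measurable fun t : Circle ↦ (t : ℂ) := by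
  have h : Continuous fun t : Circle ↦ (t : ℂ) := by fun_prop
  exact h.measurable

open Real in
theorem integrable_m_of_circleIntegrable {f : ℂ → ℝ} (hf : Measurable f)
    (h : CircleIntegrable f 0 1) : Integrable (fun t : Circle ↦ f t) m := by
  have hm : Measurable fun t : Circle ↦ f t := hf.comp measurable_circle_coe
  unfold m
  refine Integrable.smul_measure ?_ ENNReal.ofReal_ne_top
  rw [integrable_map_measure hm.aestronglyMeasurable Circle.exp.continuous.measurable.aemeasurable]
  have hp : Function.Periodic (fun θ : ℝ ↦ f (circleMap 0 1 θ)) (2 * π) := fun θ ↦ by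
    simp only [periodic_circleMap 0 1 θ]
  have h1 : IntervalIntegrable (fun θ : ℝ ↦ f (circleMap 0 1 θ)) volume (-π) π := by
    exact hp.intervalIntegrable₀ two_pi_pos.ne' h (-π) π
  rw [intervalIntegrable_iff_integrableOn_Ioc_of_le (by linarith [pi_pos])] at h1
  refine h1.congr (ae_of_all _ fun θ ↦ ?_)
  simp [circleMap, Circle.coe_exp]

open Real in
theorem integral_m_eq_circleAverage {f : ℂ → ℝ} (hf : Measurable f) :
    ∫ t : Circle, f t ∂m = circleAverage f 0 1 := by
  have hm : Measurable fun t : Circle ↦ f t := hf.comp measurable_circle_coe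
  have hp : Function.Periodic (fun θ : ℝ ↦ f (circleMap 0 1 θ)) (2 * π) := fun θ ↦ by
    simp only [periodic_circleMap 0 1 θ]
  unfold m
  rw [integral_smul_measure, integral_map Circle.exp.continuous.measurable.aemeasurable
    hm.aestronglyMeasurable, ENNReal.toReal_ofReal (by positivity), circleAverage_def,
    ← intervalIntegral.integral_of_le (by linarith [pi_pos])]
  congr 1
  have := hp.intervalIntegral_add_eq (-π) 0
  rw [show -π + 2 * π = π by ring, zero_add] at this
  rw [← this]
  congr 1
  ext θ
  simp [circleMap, Circle.coe_exp]

instance nullSingletonClass_m : NullSingletonClass m := by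
  refine ⟨fun t ↦ ?_⟩
  have h : (Circle.exp ⁻¹' {t}).Countable := by
    have := (countable_singleton (t : ℂ)).preimage_circleMap 0 (one_ne_zero (α := ℝ))
    refine this.mono fun θ hθ ↦ ?_
    simp only [mem_preimage, mem_singleton_iff] at hθ ⊢
    simp [circleMap, ← hθ, Circle.coe_exp]
  rw [m, Measure.smul_apply, Measure.map_apply Circle.exp.continuous.measurable
    (measurableSet_singleton t), h.measure_zero]
  simp

theorem ae_eval_ne_zero {p : Polynomial ℂ} (hp : p ≠ 0) :
    ∀ᵐ t : Circle ∂m, p.eval (t : ℂ) ≠ 0 := by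
  have h : {t : Circle | p.eval (t : ℂ) = 0}.Finite := by
    refine Set.Finite.of_finite_image (f := fun t : Circle ↦ (t : ℂ)) ?_
      Circle.coe_injective.injOn
    refine (Polynomial.finite_setOfPred_isRoot hp).subset ?_
    rintro _ ⟨t, ht, rfl⟩
    exact ht
  rw [ae_iff]
  simpa using h.measure_zero m

theorem integrable_log_norm_eval (p : Polynomial ℂ) :
    Integrable (fun t : Circle ↦ Real.log ‖p.eval (t : ℂ)‖) m :=
  integrable_m_of_circleIntegrable (f := fun z ↦ Real.log ‖p.eval z‖) (by fun_prop)
    (p.intervalIntegrable_mahlerMeasure)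

/-- By Jensen's formula the integral is the sum of `log⁺ |a|` over the roots. -/
theorem integral_log_norm_eval_nonneg {p : Polynomial ℂ} (hp : p.Monic) :
    0 ≤ ∫ t : Circle, Real.log ‖p.eval (t : ℂ)‖ ∂m := by
  rw [integral_m_eq_circleAverage (f := fun z ↦ Real.log ‖p.eval z‖) (by fun_prop),
    ← Polynomial.logMahlerMeasure_def,
    Polynomial.logMahlerMeasure_eq_log_leadingCoeff_add_sum_log_roots, hp.leadingCoeff]
  simp only [norm_one, Real.log_one, zero_add]
  refine Multiset.sum_nonneg fun x hx ↦ ?_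
  obtain ⟨a, -, rfl⟩ := Multiset.mem_map.1 hx
  exact Real.posLog_nonneg

/-! ### Poisson–Jensen estimate outside the disc. -/

open Real Complex Metric in
-- `|1 - āz|` and `|z - a|` agree on the circle, and one of their logarithms is harmonic on the
-- closed disc unless `|a| = 1`. For `|a| > 1` it is `log |z - a|`, which dominates inside the disc
-- by the identity `key`.
theorem log_norm_one_sub_conj_mul_le_circleAverage {w a : ℂ} (hw : w ∈ ball (0 : ℂ) 1)
    (ha : 1 - (starRingEnd ℂ) a * w ≠ 0) :
    Real.log ‖1 - (starRingEnd ℂ) a * w‖ ≤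
      circleAverage ((Complex.re ∘ herglotzRieszKernel 0 w) • (Real.log ‖· - a‖)) 0 1 := by
  have hw' : ‖w‖ < 1 := by simpa using hw
  have key (z : ℂ) : ‖1 - (starRingEnd ℂ) a * z‖ ^ 2 - ‖z - a‖ ^ 2 =
      (1 - ‖a‖ ^ 2) * (1 - ‖z‖ ^ 2) := by
    simp only [← normSq_eq_norm_sq, normSq_apply]
    simp
    ring
  rcases lt_trichotomy ‖a‖ 1 with h | h | h
  · have hne : ∀ z ∈ closedBall (0 : ℂ) 1, 1 - (starRingEnd ℂ) a * z ≠ 0 := by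
      intro z hz h0
      have h1 : ‖(starRingEnd ℂ) a * z‖ = 1 := by rw [← sub_eq_zero.1 h0, norm_one]
      rw [norm_mul, RCLike.norm_conj] at h1
      have hz' : ‖z‖ ≤ 1 := by simpa using hz
      nlinarith [norm_nonneg a, norm_nonneg z]
    have hh : InnerProductSpace.HarmonicOnNhd
        (fun z ↦ Real.log ‖1 - (starRingEnd ℂ) a * z‖) (closedBall (0 : ℂ) 1) := fun z hz ↦
      AnalyticAt.harmonicAt_log_norm (f := fun z ↦ 1 - (starRingEnd ℂ) a * z)
        (by fun_prop) (hne z hz)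
    rw [← hh.circleAverage_re_herglotzRieszKernel_smul hw]
    refine le_of_eq (circleAverage_congr_sphere fun z hz ↦ ?_)
    have hz' : ‖z‖ = 1 := by simpa using hz
    have hk := key z
    rw [hz', one_pow, sub_self, mul_zero, sub_eq_zero] at hk
    have := (sq_eq_sq₀ (norm_nonneg _) (norm_nonneg _)).1 hk
    simp [this]
  · have := circleAverage_re_herglotzRieszKernel_mul_log₀ (ρ := a) (by simpa using h) hw
    rw [this]
    have hk := key w
    rw [h, one_pow, sub_self, zero_mul, sub_eq_zero] at hk
    exact (congrArg Real.log ((sq_eq_sq₀ (norm_nonneg _) (norm_nonneg _)).1 hk)).le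
  · have hh : InnerProductSpace.HarmonicOnNhd
        (fun z ↦ Real.log ‖z - a‖) (closedBall (0 : ℂ) 1) := fun z hz ↦ by
      refine AnalyticAt.harmonicAt_log_norm (f := fun z ↦ z - a) (by fun_prop) ?_
      intro h0
      have hz' : ‖z‖ ≤ 1 := by simpa using hz
      rw [sub_eq_zero.1 h0] at hz'
      linarith
    rw [hh.circleAverage_re_herglotzRieszKernel_smul hw]
    refine Real.log_le_log (norm_pos_iff.2 ha) ?_
    refine (sq_le_sq₀ (norm_nonneg _) (norm_nonneg _)).1 ?_
    have hk := key w
    have : (1 - ‖a‖ ^ 2) * (1 - ‖w‖ ^ 2) ≤ 0 :=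
      mul_nonpos_of_nonpos_of_nonneg (by nlinarith) (by nlinarith [norm_nonneg w])
    linarith

/-- The Poisson kernel with pole `w`, as a function on the circle. -/
noncomputable def circlePoisson (w : ℂ) (t : Circle) : ℝ := (herglotzRieszKernel 0 w t).re

theorem measurable_circlePoisson (w : ℂ) : Measurable (circlePoisson w) := by
  have := measurable_circle_coe
  unfold circlePoisson herglotzRieszKernel
  fun_prop

open Metric in
theorem circlePoisson_nonneg {w : ℂ} (hw : w ∈ ball (0 : ℂ) 1) (t : Circle) :
    0 ≤ circlePoisson w t := by
  have hw' : ‖w‖ < 1 := by simpa using hw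
  refine le_trans ?_ (le_re_herglotzRieszKernel (c := 0) (R := 1) (z := (t : ℂ))
    (mem_sphere_zero_iff_norm.2 (Circle.norm_coe t)) hw)
  rw [sub_zero]
  have := norm_nonneg w
  exact div_nonneg (by linarith) (by linarith)

open Metric in
theorem circlePoisson_le {w : ℂ} (hw : w ∈ ball (0 : ℂ) 1) (t : Circle) :
    circlePoisson w t ≤ (1 + ‖w‖) / (1 - ‖w‖) := by
  have := re_herglotzRieszKernel_le (c := 0) (R := 1) (z := (t : ℂ))
    (mem_sphere_zero_iff_norm.2 (Circle.norm_coe t)) hw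
  simp only [sub_zero] at this
  simpa only [circlePoisson, herglotzRieszKernel, sub_zero] using this

open Metric in
theorem integral_circlePoisson {w : ℂ} (hw : w ∈ ball (0 : ℂ) 1) :
    ∫ t, circlePoisson w t ∂m = 1 := by
  have hm : Measurable fun z ↦ (herglotzRieszKernel 0 w z).re := by
    unfold herglotzRieszKernel
    fun_prop
  have h : InnerProductSpace.HarmonicOnNhd (fun _ : ℂ ↦ (1 : ℝ)) (closedBall (0 : ℂ) 1) :=
    fun z _ ↦ InnerProductSpace.harmonicAt_const _
  have := h.circleAverage_re_herglotzRieszKernel_smul hw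
  rw [← this]
  rw [← integral_m_eq_circleAverage]
  · simp [circlePoisson]
  · change Measurable fun z ↦ (herglotzRieszKernel 0 w z).re * 1
    exact hm.mul_const 1

open Metric in
theorem integrable_circlePoisson_mul {w : ℂ} (hw : w ∈ ball (0 : ℂ) 1) {f : Circle → ℝ}
    (hf : Integrable f m) : Integrable (fun t ↦ circlePoisson w t * f t) m := by
  refine hf.bdd_mul (c := (1 + ‖w‖) / (1 - ‖w‖))
    (measurable_circlePoisson w).aestronglyMeasurable (ae_of_all _ fun t ↦ ?_)
  rw [Real.norm_of_nonneg (circlePoisson_nonneg hw t)]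
  exact circlePoisson_le hw t

open Metric in
theorem log_norm_one_sub_conj_mul_le_integral {w a : ℂ} (hw : w ∈ ball (0 : ℂ) 1)
    (ha : 1 - (starRingEnd ℂ) a * w ≠ 0) :
    Real.log ‖1 - (starRingEnd ℂ) a * w‖ ≤
      ∫ t : Circle, circlePoisson w t * Real.log ‖(t : ℂ) - a‖ ∂m := by
  refine (log_norm_one_sub_conj_mul_le_circleAverage hw ha).trans_eq ?_
  rw [← integral_m_eq_circleAverage]
  · rfl
  · unfold herglotzRieszKernel
    change Measurable fun z ↦ ((z - 0 + (w - 0)) / (z - 0 - (w - 0))).re * Real.log ‖z - a‖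
    fun_prop

open Metric in
-- Reflection `w = 1 / z̄` moves `z` into the disc and `|z - a| = |z| |1 - āw|`, so each root costs
-- `log |z|` plus a Poisson integral.
theorem log_norm_prod_sub_le {z : ℂ} (hz : 1 < ‖z‖) (s : Multiset ℂ)
    (hs : ∀ a ∈ s, z ≠ a) :
    Real.log ‖(s.map fun a ↦ z - a).prod‖ ≤ Multiset.card s * Real.log ‖z‖ +
      ∫ t : Circle, circlePoisson ((starRingEnd ℂ) z)⁻¹ t *
        Real.log ‖(s.map fun a ↦ (t : ℂ) - a).prod‖ ∂m := by
  have hw : ((starRingEnd ℂ) z)⁻¹ ∈ ball (0 : ℂ) 1 := by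
    simpa using inv_lt_one_of_one_lt₀ hz
  have hz0 : z ≠ 0 := by rintro rfl; norm_num at hz
  have hcz : (starRingEnd ℂ) z ≠ 0 := by simpa using hz0
  have hev (s : Multiset ℂ) (t : ℂ) : (s.map fun a ↦ t - a).prod =
      ((s.map fun a ↦ Polynomial.X - Polynomial.C a).prod).eval t := by
    simp [Polynomial.eval_multiset_prod, Multiset.map_map]
  induction s using Multiset.induction_on with
  | empty => simp
  | cons a s ih =>
    have ih := ih fun b hb ↦ hs b (Multiset.mem_cons_of_mem hb)
    have hza : z - a ≠ 0 := sub_ne_zero.2 (hs a (Multiset.mem_cons_self a s))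
    have hprod : (s.map fun a ↦ z - a).prod ≠ 0 := by
      refine Multiset.prod_ne_zero fun h0 ↦ ?_
      obtain ⟨b, hb, hb0⟩ := Multiset.mem_map.1 h0
      exact hs b (Multiset.mem_cons_of_mem hb) (sub_eq_zero.1 hb0)
    have hfac : ‖z - a‖ = ‖z‖ * ‖1 - (starRingEnd ℂ) a * ((starRingEnd ℂ) z)⁻¹‖ := by
      rw [← RCLike.norm_conj (z - a), ← RCLike.norm_conj z, ← norm_mul, map_sub]
      congr 1
      field_simp
    have hne : 1 - (starRingEnd ℂ) a * ((starRingEnd ℂ) z)⁻¹ ≠ 0 := by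
      intro h0
      rw [h0, norm_zero, mul_zero, norm_eq_zero] at hfac
      exact hza hfac
    have h1 := log_norm_one_sub_conj_mul_le_integral hw hne
    have hi1 : Integrable (fun t : Circle ↦ Real.log ‖(t : ℂ) - a‖) m := by
      have h (x : ℂ) : (Polynomial.X - Polynomial.C a).eval x = x - a := by simp
      refine (integrable_log_norm_eval (Polynomial.X - Polynomial.C a)).congr
        (ae_of_all _ fun t ↦ ?_)
      exact congrArg (fun x ↦ Real.log ‖x‖) (h t)
    have hi2 : Integrable (fun t : Circle ↦ Real.log ‖(s.map fun a ↦ (t : ℂ) - a).prod‖) m := by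
      simp_rw [hev s]
      exact integrable_log_norm_eval _
    have hae : ∀ᵐ t : Circle ∂m, circlePoisson ((starRingEnd ℂ) z)⁻¹ t *
        Real.log ‖((a ::ₘ s).map fun a ↦ (t : ℂ) - a).prod‖ =
        circlePoisson ((starRingEnd ℂ) z)⁻¹ t * Real.log ‖(t : ℂ) - a‖ +
        circlePoisson ((starRingEnd ℂ) z)⁻¹ t *
          Real.log ‖(s.map fun a ↦ (t : ℂ) - a).prod‖ := by
      have hmon := Polynomial.monic_multiset_prod_of_monic (a ::ₘ s)
        (fun a ↦ Polynomial.X - Polynomial.C a) fun b _ ↦ Polynomial.monic_X_sub_C b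
      filter_upwards [ae_eval_ne_zero hmon.ne_zero] with t ht
      rw [← hev, Multiset.map_cons, Multiset.prod_cons] at ht
      rw [Multiset.map_cons, Multiset.prod_cons, norm_mul,
        Real.log_mul (norm_ne_zero_iff.2 (left_ne_zero_of_mul ht))
          (norm_ne_zero_iff.2 (right_ne_zero_of_mul ht)), mul_add]
    rw [integral_congr_ae hae, integral_add (integrable_circlePoisson_mul hw hi1)
      (integrable_circlePoisson_mul hw hi2), Multiset.map_cons, Multiset.prod_cons, norm_mul,
      Real.log_mul (norm_ne_zero_iff.2 hza) (norm_ne_zero_iff.2 hprod), hfac,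
      Real.log_mul (norm_ne_zero_iff.2 hz0) (norm_ne_zero_iff.2 hne), Multiset.card_cons]
    push_cast
    linarith

open Metric in
-- One kernel serves all `t`: its pole is the reflection of a point of `|z| = R` where `|p|` is
-- maximal on the closed disc.
theorem exists_poisson_majorant {p : Polynomial ℂ} (hp : p.Monic) {R : ℝ} (hR : 1 < R) :
    ∃ P : Circle → ℝ, Measurable P ∧ (∀ t, 0 ≤ P t) ∧ (∀ t, P t ≤ (R + 1) / (R - 1)) ∧
      ∫ t, P t ∂m = 1 ∧
      ∀ t : Circle, ‖p.eval (t : ℂ)‖ ≤ Real.exp (p.natDegree * Real.log R +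
        ∫ s : Circle, P s * Real.log ‖p.eval (s : ℂ)‖ ∂m) := by
  have hR0 : 0 < R := by linarith
  obtain ⟨z, hz, hmax⟩ := Complex.exists_mem_frontier_isMaxOn_norm
    (f := fun z ↦ p.eval z) (U := ball (0 : ℂ) R) isBounded_ball ⟨0, by simpa using hR0⟩
    p.differentiable.diffContOnCl
  rw [frontier_ball _ hR0.ne', mem_sphere_zero_iff_norm] at hz
  have hle (t : Circle) : ‖p.eval (t : ℂ)‖ ≤ ‖p.eval z‖ :=
    hmax (subset_closure (by
      rw [mem_ball_zero_iff, Circle.norm_coe]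
      exact hR))
  have hw : ((starRingEnd ℂ) z)⁻¹ ∈ ball (0 : ℂ) 1 := by
    simpa [hz] using inv_lt_one_of_one_lt₀ hR
  have hpz : p.eval z ≠ 0 := by
    intro h0
    obtain ⟨t, ht⟩ := (ae_eval_ne_zero hp.ne_zero).exists
    have := hle t
    rw [h0, norm_zero] at this
    exact ht (norm_le_zero_iff.1 this)
  have hev (x : ℂ) : p.eval x = (p.roots.map fun a ↦ x - a).prod :=
    (IsAlgClosed.splits p).eval_eq_prod_roots_of_monic hp x
  refine ⟨circlePoisson ((starRingEnd ℂ) z)⁻¹, measurable_circlePoisson _,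
    circlePoisson_nonneg hw, fun t ↦ (circlePoisson_le hw t).trans_eq ?_,
    integral_circlePoisson hw, fun t ↦ (hle t).trans ?_⟩
  · rw [norm_inv, RCLike.norm_conj, hz]
    have : R - 1 ≠ 0 := by linarith
    field_simp
  · rw [← Real.log_le_iff_le_exp (norm_pos_iff.2 hpz)]
    have := log_norm_prod_sub_le (z := z) (by rw [hz]; exact hR) p.roots (by
      rintro a ha rfl
      exact hpz (Polynomial.isRoot_of_mem_roots ha))
    simp_rw [← hev, hz] at this
    rwa [← (IsAlgClosed.splits p).natDegree_eq_card_roots] at this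

/-! ### Remez-type inequality. -/

theorem continuous_norm_eval_sq (p : Polynomial ℂ) :
    Continuous fun t : Circle ↦ ‖p.eval (t : ℂ)‖ ^ 2 := by
  have h : Continuous fun t : Circle ↦ (t : ℂ) := by fun_prop
  exact (p.continuous.comp h).norm.pow 2

theorem integrable_norm_eval_sq (p : Polynomial ℂ) (μ : Measure Circle) [IsFiniteMeasure μ] :
    Integrable (fun t : Circle ↦ ‖p.eval (t : ℂ)‖ ^ 2) μ :=
  (continuous_norm_eval_sq p).integrable_of_hasCompactSupport
    (HasCompactSupport.of_compactSpace _)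

/-- The tangent line to the logarithm at `c`. -/
theorem log_le_div_add_log_sub_one {x c : ℝ} (hx : 0 < x) (hc : 0 < c) :
    Real.log x ≤ x / c + (Real.log c - 1) := by
  have := Real.log_le_sub_one_of_pos (div_pos hx hc)
  rw [Real.log_div hx.ne' hc.ne'] at this
  linarith

/-- The Remez-type majorant of `log |p|` for monic `p` of degree `n` with
`∫ |p|² ≤ exp A` off a set of measure `ε`. -/
noncomputable def remezBound (n : ℕ) (ε A : ℝ) : ℝ :=
  2 / (1 - ε) * (n * (4 * ε / (1 - ε)) + (A + Real.log ε⁻¹ + 1) / 2)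

/-- The Poisson bound `M` majorizes `log |p|`, so it can be inserted on `E`, where the kernel has
mass at most `(1 + ε) / 2`. This gives `M ≤ nδ + M (1 + ε) / 2 + (contribution of Eᶜ)`, to be solved
for `M`. -/
theorem log_norm_eval_le_remezBound {p : Polynomial ℂ} (hp : p.Monic) {E : Set Circle}
    (hE : MeasurableSet E) {A : ℝ} (hA : 0 ≤ A) (hE0 : 0 < m.real E) (hE1 : m.real E < 1)
    (hint : ∫ t in Eᶜ, ‖p.eval (t : ℂ)‖ ^ 2 ∂m ≤ Real.exp A) (t : Circle) :
    Real.log ‖p.eval (t : ℂ)‖ ≤ remezBound p.natDegree (m.real E) A := by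
  set ε := m.real E with hε
  set φ : Circle → ℝ := fun t ↦ Real.log ‖p.eval (t : ℂ)‖ with hφ
  have h1ε : 0 < 1 - ε := by linarith
  -- Chosen so that the kernel bound `(2 + δ) / δ` equals `(1 + ε) / (2 * ε)`.
  set δ : ℝ := 4 * ε / (1 - ε) with hδ
  have hδ0 : 0 < δ := by positivity
  obtain ⟨P, hPm, hP0, hPle, hP1, hPp⟩ := exists_poisson_majorant hp (R := 1 + δ) (by linarith)
  set b : ℝ := (1 + ε) / (2 * ε) with hb
  have hPb (t : Circle) : P t ≤ b := by
    refine (hPle t).trans_eq ?_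
    rw [hb, hδ]
    field_simp
    ring
  have hb0 : 0 < b := by positivity
  set M : ℝ := p.natDegree * Real.log (1 + δ) + ∫ s, P s * φ s ∂m with hM
  have hPb' : ∀ᵐ t ∂m, ‖P t‖ ≤ b := ae_of_all _ fun t ↦ by
    rw [Real.norm_of_nonneg (hP0 t)]
    exact hPb t
  have hφi : Integrable φ m := integrable_log_norm_eval p
  have hPφ : Integrable (fun t ↦ P t * φ t) m := hφi.bdd_mul hPm.aestronglyMeasurable hPb'
  have hPi : Integrable P m := Integrable.of_bound hPm.aestronglyMeasurable b hPb'
  have hPq : Integrable (fun t : Circle ↦ P t * ‖p.eval (t : ℂ)‖ ^ 2) m :=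
    (integrable_norm_eval_sq p m).bdd_mul hPm.aestronglyMeasurable hPb'
  have hφM : ∀ᵐ t ∂m, φ t ≤ M := by
    filter_upwards [ae_eval_ne_zero hp.ne_zero] with t ht
    rw [hφ, Real.log_le_iff_le_exp (norm_pos_iff.2 ht)]
    exact hPp t
  have hM0 : 0 ≤ M := by
    refine (integral_log_norm_eval_nonneg hp).trans ?_
    refine (integral_mono_ae hφi (integrable_const M) hφM).trans_eq ?_
    simp
  have hEint : ∫ t in E, P t * φ t ∂m ≤ M * ((1 + ε) / 2) := by
    calc ∫ t in E, P t * φ t ∂m ≤ ∫ t in E, b * M ∂m := by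
          refine integral_mono_ae hPφ.integrableOn (integrable_const _) ?_
          filter_upwards [ae_restrict_of_ae hφM] with t ht
          exact (mul_le_mul_of_nonneg_left ht (hP0 t)).trans
            (mul_le_mul_of_nonneg_right (hPb t) hM0)
      _ = M * ((1 + ε) / 2) := by
          rw [setIntegral_const, smul_eq_mul, ← hε, hb]
          field_simp
  -- An upper bound for `∫_{Eᶜ} P |p|²`; the tangent to `log` at `c` replaces Jensen's inequality.
  set c : ℝ := Real.exp A / ε with hc
  have hc0 : 0 < c := by positivity
  have hlogc : Real.log c = A + Real.log ε⁻¹ := by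
    rw [hc, Real.log_div (Real.exp_pos A).ne' hE0.ne', Real.log_exp, Real.log_inv, sub_eq_add_neg]
  have hlogε : 0 ≤ Real.log ε⁻¹ := Real.log_nonneg ((one_le_inv₀ hE0).2 hE1.le)
  have hs1 : ∫ t in Eᶜ, P t ∂m ≤ 1 := by
    rw [← hP1]
    exact setIntegral_le_integral hPi (ae_of_all _ hP0)
  have hs0 : 0 ≤ ∫ t in Eᶜ, P t ∂m := integral_nonneg hP0
  have hFint : 2 * ∫ t in Eᶜ, P t * φ t ∂m ≤ A + Real.log ε⁻¹ + 1 := by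
    have hq : ∫ t in Eᶜ, P t * ‖p.eval (t : ℂ)‖ ^ 2 ∂m ≤ c := by
      calc ∫ t in Eᶜ, P t * ‖p.eval (t : ℂ)‖ ^ 2 ∂m
          ≤ ∫ t in Eᶜ, b * ‖p.eval (t : ℂ)‖ ^ 2 ∂m := by
            refine integral_mono hPq.integrableOn
              ((integrable_norm_eval_sq p m).const_mul b).integrableOn fun t ↦ ?_
            exact mul_le_mul_of_nonneg_right (hPb t) (sq_nonneg _)
        _ = b * ∫ t in Eᶜ, ‖p.eval (t : ℂ)‖ ^ 2 ∂m := integral_const_mul _ _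
        _ ≤ b * Real.exp A := mul_le_mul_of_nonneg_left hint hb0.le
        _ ≤ ε⁻¹ * Real.exp A := by
            refine mul_le_mul_of_nonneg_right ?_ (Real.exp_pos A).le
            rw [hb, div_le_iff₀ (by positivity)]
            field_simp
            linarith
        _ = c := by rw [hc]; ring
    calc 2 * ∫ t in Eᶜ, P t * φ t ∂m = ∫ t in Eᶜ, 2 * (P t * φ t) ∂m :=
          (integral_const_mul _ _).symm
      _ ≤ ∫ t in Eᶜ, (P t * ‖p.eval (t : ℂ)‖ ^ 2 * c⁻¹ + P t * (Real.log c - 1)) ∂m := by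
          refine integral_mono_ae (hPφ.const_mul 2).integrableOn
            ((hPq.mul_const _).add (hPi.mul_const _)).integrableOn ?_
          filter_upwards [ae_restrict_of_ae (ae_eval_ne_zero hp.ne_zero)] with t ht
          have h := log_le_div_add_log_sub_one (pow_pos (norm_pos_iff.2 ht) 2) hc0
          rw [Real.log_pow] at h
          have h' := mul_le_mul_of_nonneg_left h (hP0 t)
          push_cast at h'
          calc 2 * (P t * φ t) = P t * (2 * φ t) := by ring
            _ ≤ _ := h'
            _ = _ := by ring
      _ = (∫ t in Eᶜ, P t * ‖p.eval (t : ℂ)‖ ^ 2 ∂m) * c⁻¹ +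
            (∫ t in Eᶜ, P t ∂m) * (Real.log c - 1) := by
          rw [integral_add (hPq.mul_const _).integrableOn (hPi.mul_const _).integrableOn,
            integral_mul_const, integral_mul_const]
      _ ≤ 1 + 1 * (A + Real.log ε⁻¹) := by
          refine add_le_add ?_ ?_
          · rw [← div_eq_mul_inv]
            exact (div_le_one hc0).2 hq
          · rw [hlogc]
            nlinarith
      _ = A + Real.log ε⁻¹ + 1 := by ring
  have hsplit := integral_add_compl hE hPφ
  have hlogδ : Real.log (1 + δ) ≤ δ := by
    linarith [Real.log_le_sub_one_of_pos (show 0 < 1 + δ by linarith)]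
  have hnδ : p.natDegree * Real.log (1 + δ) ≤ p.natDegree * δ :=
    mul_le_mul_of_nonneg_left hlogδ (Nat.cast_nonneg _)
  have hMle : M ≤ remezBound p.natDegree ε A := by
    have : M * ((1 - ε) / 2) ≤ p.natDegree * δ + (A + Real.log ε⁻¹ + 1) / 2 := by linarith
    rw [remezBound, div_mul_eq_mul_div, le_div_iff₀ h1ε]
    linarith
  -- At a zero of `p` the logarithm takes the value `0`, so `0 ≤ M` is needed.
  by_cases ht : p.eval (t : ℂ) = 0
  · rw [ht, norm_zero, Real.log_zero]
    exact hM0.trans hMle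
  · rw [Real.log_le_iff_le_exp (norm_pos_iff.2 ht)]
    exact (hPp t).trans (Real.exp_le_exp.2 hMle)

/-! ### The distribution function and truncations of `H`. -/

theorem measurableSet_superlevel {H : Circle → ℝ≥0∞} (hH : Measurable H) (A : ℝ) :
    MeasurableSet {t | ENNReal.ofReal A < H t} :=
  measurableSet_lt measurable_const hH

theorem le_of_notMem_superlevel {H : Circle → ℝ≥0∞} {A : ℝ} {t : Circle}
    (ht : t ∈ {t | ENNReal.ofReal A < H t}ᶜ) : H t ≤ ENNReal.ofReal A :=
  not_lt.1 fun h ↦ ht h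

theorem distribFun_nonneg (H : Circle → ℝ≥0∞) (a : ℝ) : 0 ≤ distribFun H a := measureReal_nonneg

theorem antitone_distribFun (H : Circle → ℝ≥0∞) : Antitone (distribFun H) := fun a b hab ↦
  measureReal_mono fun _ ht ↦ (ENNReal.ofReal_le_ofReal hab).trans_lt ht

/-- Layer-cake formula: truncation at `A` leaves the levels below `A` unchanged and empties the
others. -/
theorem integral_truncation {H : Circle → ℝ≥0∞} (hH : Measurable H) {A : ℝ} (hA : 0 ≤ A) :
    ∫ t, (min (H t) (ENNReal.ofReal A)).toReal ∂m = ∫ a in (0 : ℝ)..A, distribFun H a := by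
  have hle (t : Circle) : (min (H t) (ENNReal.ofReal A)).toReal ≤ A :=
    ENNReal.toReal_le_of_le_ofReal hA (min_le_right _ _)
  have hi : Integrable (fun t ↦ (min (H t) (ENNReal.ofReal A)).toReal) m := by
    refine Integrable.of_bound (hH.min measurable_const).ennreal_toReal.aestronglyMeasurable A
      (ae_of_all _ fun t ↦ ?_)
    rw [Real.norm_of_nonneg ENNReal.toReal_nonneg]
    exact hle t
  rw [hi.integral_eq_integral_meas_lt (ae_of_all _ fun t ↦ ENNReal.toReal_nonneg),
    intervalIntegral.integral_of_le hA, integral_Ioc_eq_integral_Ioo,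
    setIntegral_eq_of_subset_of_ae_sdiff_eq_zero nullMeasurableSet_Ioi Ioo_subset_Ioi_self ?_]
  · refine setIntegral_congr_fun measurableSet_Ioo fun a ha ↦ ?_
    refine congrArg m.real (Set.ext fun t ↦ ?_)
    change a < (min (H t) (ENNReal.ofReal A)).toReal ↔ ENNReal.ofReal a < H t
    rw [← ENNReal.ofReal_lt_iff_lt_toReal ha.1.le
      ((min_le_right _ _).trans_lt ENNReal.ofReal_lt_top).ne, lt_min_iff, and_iff_left]
    exact (ENNReal.ofReal_lt_ofReal_iff_of_nonneg ha.1.le).2 ha.2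
  · refine ae_of_all _ fun a ha ↦ ?_
    have haA : A ≤ a := not_lt.1 fun h ↦ ha.2 ⟨ha.1, h⟩
    have h : {t | a < (min (H t) (ENNReal.ofReal A)).toReal} = ∅ :=
      eq_empty_of_forall_notMem fun t ht ↦ absurd (lt_of_lt_of_le ht (hle t)) (not_lt.2 haA)
    rw [h, measureReal_empty]

theorem setIntegral_toReal_le {H : Circle → ℝ≥0∞} (hH : Measurable H) {A : ℝ} (hA : 0 ≤ A) :
    ∫ t in {t | ENNReal.ofReal A < H t}ᶜ, (H t).toReal ∂m ≤
      ∫ a in (0 : ℝ)..A, distribFun H a := by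
  have hE := measurableSet_superlevel hH A
  rw [← integral_truncation hH hA]
  calc ∫ t in {t | ENNReal.ofReal A < H t}ᶜ, (H t).toReal ∂m
      = ∫ t in {t | ENNReal.ofReal A < H t}ᶜ, (min (H t) (ENNReal.ofReal A)).toReal ∂m :=
        setIntegral_congr_fun hE.compl fun t ht ↦ by
          rw [min_eq_left (le_of_notMem_superlevel ht)]
    _ ≤ ∫ t, (min (H t) (ENNReal.ofReal A)).toReal ∂m := by
        refine setIntegral_le_integral ?_ (ae_of_all _ fun t ↦ ENNReal.toReal_nonneg)
        refine Integrable.of_bound (hH.min measurable_const).ennreal_toReal.aestronglyMeasurable A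
          (ae_of_all _ fun t ↦ ?_)
        rw [Real.norm_of_nonneg ENNReal.toReal_nonneg]
        exact ENNReal.toReal_le_of_le_ofReal hA (min_le_right _ _)

theorem mul_distribFun_le {H : Circle → ℝ≥0∞} {A : ℝ} (hA : 0 ≤ A) :
    A * distribFun H A ≤ ∫ a in (0 : ℝ)..A, distribFun H a := by
  have := intervalIntegral.integral_mono_on hA
    (intervalIntegrable_const (c := distribFun H A)) (antitone_distribFun H).intervalIntegrable
    (fun a ha ↦ antitone_distribFun H ha.2) (μ := volume)
  simpa using this

theorem integral_distribFun_mono {H : Circle → ℝ≥0∞} {A B : ℝ} (hA : 0 ≤ A) (hAB : A ≤ B) :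
    ∫ a in (0 : ℝ)..A, distribFun H a ≤ ∫ a in (0 : ℝ)..B, distribFun H a :=
  intervalIntegral.integral_mono_interval le_rfl hA hAB
    (ae_of_all _ fun a ↦ distribFun_nonneg H a) (antitone_distribFun H).intervalIntegrable

theorem tendsto_integral_distribFun {H : Circle → ℝ≥0∞} (hH : Measurable H)
    (hint : ∫⁻ t, H t ∂m = ∞) :
    Tendsto (fun k : ℕ ↦ ∫ a in (0 : ℝ)..k, distribFun H a) atTop atTop := by
  have h1 : Tendsto (fun k : ℕ ↦ ∫⁻ t, min (H t) (ENNReal.ofReal k) ∂m) atTop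
      (nhds (∫⁻ t, H t ∂m)) := by
    refine lintegral_tendsto_of_tendsto_of_monotone
      (fun k ↦ (hH.min measurable_const).aemeasurable)
      (ae_of_all _ fun t i j hij ↦ min_le_min_left _
        (ENNReal.ofReal_le_ofReal (Nat.cast_le.2 hij))) (ae_of_all _ fun t ↦ ?_)
    have h2 : Tendsto (fun k : ℕ ↦ ENNReal.ofReal k) atTop (nhds ∞) := by
      simpa using ENNReal.tendsto_nat_nhds_top
    simpa using (tendsto_const_nhds (x := H t)).min h2
  rw [hint] at h1
  have h3 (k : ℕ) : ∫⁻ t, min (H t) (ENNReal.ofReal k) ∂m =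
      ENNReal.ofReal (∫ a in (0 : ℝ)..k, distribFun H a) := by
    rw [← integral_truncation hH (Nat.cast_nonneg k), integral_toReal, ENNReal.ofReal_toReal]
    · refine ((lintegral_mono fun t ↦ min_le_right _ _).trans_lt ?_).ne
      rw [lintegral_const, measure_univ, mul_one]
      exact ENNReal.ofReal_lt_top
    · exact (hH.min measurable_const).aemeasurable
    · exact ae_of_all _ fun t ↦ (min_le_right _ _).trans_lt ENNReal.ofReal_lt_top
  simp_rw [h3] at h1
  rw [tendsto_atTop]
  intro b
  filter_upwards [h1.eventually (lt_mem_nhds (ENNReal.ofReal_lt_top (r := b)))] with k hk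
  exact (ENNReal.ofReal_lt_ofReal_iff'.1 hk).1.le

theorem tendsto_distribFun {H : Circle → ℝ≥0∞} (hH : Measurable H) :
    Tendsto (fun k : ℕ ↦ distribFun H k) atTop (nhds (m.real {t | H t = ∞})) := by
  have h : {t | H t = ∞} = ⋂ k : ℕ, {t | ENNReal.ofReal k < H t} := by
    ext t
    simp only [mem_ofPred_eq, mem_iInter]
    refine ⟨fun ht k ↦ by rw [ht]; exact ENNReal.ofReal_lt_top, fun ht ↦ ?_⟩
    by_contra hne
    obtain ⟨k, hk⟩ := ENNReal.exists_nat_gt hne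
    have := (ht k).trans hk
    simp at this
  rw [h]
  refine (ENNReal.tendsto_toReal (measure_ne_top _ _)).comp
    (tendsto_measure_iInter_atTop
      (fun k ↦ (measurableSet_lt measurable_const hH).nullMeasurableSet)
      (fun i j hij t ht ↦ ?_) ⟨0, measure_ne_top _ _⟩)
  exact (ENNReal.ofReal_le_ofReal (Nat.cast_le.2 hij)).trans_lt ht

theorem distribFun_pos {H : Circle → ℝ≥0∞} (hint : ∫⁻ t, H t ∂m = ∞) (a : ℝ) :
    0 < distribFun H a := by
  refine (distribFun_nonneg H a).lt_of_ne' fun h ↦ ?_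
  have h0 : m {t | ENNReal.ofReal a < H t} = 0 := (measureReal_eq_zero_iff).1 h
  have : ∫⁻ t, H t ∂m ≤ ∫⁻ _, ENNReal.ofReal a ∂m := by
    refine lintegral_mono_ae ?_
    rw [ae_iff]
    simpa using h0
  rw [hint, lintegral_const, measure_univ, mul_one] at this
  exact ENNReal.ofReal_ne_top (top_le_iff.1 this)

theorem toReal_le_of_notMem_superlevel {H : Circle → ℝ≥0∞} {A : ℝ} (hA : 0 ≤ A) {t : Circle}
    (ht : t ∈ {t | ENNReal.ofReal A < H t}ᶜ) : (H t).toReal ≤ A :=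
  ENNReal.toReal_le_of_le_ofReal hA (le_of_notMem_superlevel ht)

/-! ### Bounds for the minimal norm. -/

theorem setIntegral_exp_neg_mul_le {ρ : Measure Circle} [IsFiniteMeasure ρ]
    {H : Circle → ℝ≥0∞} (hH : Measurable H) (hρ : expNegMeasure H ≤ ρ) (A : ℝ)
    (p : Polynomial ℂ) :
    ∫ t in {t | ENNReal.ofReal A < H t}ᶜ,
        Real.exp (-(H t).toReal) * ‖p.eval (t : ℂ)‖ ^ 2 ∂m ≤
      ∫ t, ‖p.eval (t : ℂ)‖ ^ 2 ∂ρ := by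
  have hE := (measurableSet_superlevel hH A).compl
  set S := {t | ENNReal.ofReal A < H t}ᶜ with hS
  have hHS {t : Circle} (ht : t ∈ S) : H t ≠ ∞ :=
    ((le_of_notMem_superlevel ht).trans_lt ENNReal.ofReal_lt_top).ne
  have hexp {t : Circle} (ht : t ∈ S) : EReal.exp (-(H t : EReal)) =
      ENNReal.ofReal (Real.exp (-(H t).toReal)) := by
    lift H t to NNReal using hHS ht with x
    rw [← EReal.exp_coe]
    rfl
  have hmeas : Measurable fun t ↦ EReal.exp (-(H t : EReal)) :=
    EReal.measurable_exp.comp hH.coe_ereal_ennreal.neg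
  have hle : (m.withDensity fun t ↦ EReal.exp (-(H t : EReal))).restrict S ≤ ρ :=
    Measure.restrict_le_self.trans hρ
  have hnn : 0 ≤ᵐ[ρ] fun t : Circle ↦ ‖p.eval (t : ℂ)‖ ^ 2 := ae_of_all _ fun t ↦ sq_nonneg _
  refine le_trans (le_of_eq ?_) (integral_mono_measure hle hnn (integrable_norm_eval_sq p ρ))
  rw [setIntegral_withDensity_eq_setIntegral_toReal_smul₀ hmeas.aemeasurable.restrict _ _ hE]
  · refine setIntegral_congr_fun hE fun t ht ↦ ?_
    simp only [smul_eq_mul]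
    rw [hexp ht, ENNReal.toReal_ofReal (Real.exp_pos _).le]
  · refine (ae_restrict_iff' hE).2 (ae_of_all _ fun t ht ↦ ?_)
    rw [hexp ht]
    exact ENNReal.ofReal_lt_top

/-- The exponent in the lower bound for `∫ |p|² dρ`, `p` monic of degree `n`; here `ε` stands for
`m {H > A}` and `h` for the integral of `H` over `{H ≤ A}`. -/
noncomputable def deficit (n : ℕ) (ε A h : ℝ) : ℝ :=
  (2 * (ε * remezBound n ε A) + h + ε) / (1 - ε)

theorem remezBound_nonneg {n : ℕ} {ε A : ℝ} (h0 : 0 < ε) (h1 : ε < 1) (hA : 0 ≤ A) :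
    0 ≤ remezBound n ε A := by
  have h1ε : 0 < 1 - ε := by linarith
  have hlogε : 0 ≤ Real.log ε⁻¹ := Real.log_nonneg ((one_le_inv₀ h0).2 h1.le)
  unfold remezBound
  positivity

theorem exp_neg_deficit_le_integral {ρ : Measure Circle} [IsFiniteMeasure ρ]
    {H : Circle → ℝ≥0∞} (hH : Measurable H) (hρ : expNegMeasure H ≤ ρ) {A : ℝ} (hA : 0 ≤ A)
    (h0 : 0 < distribFun H A) (h1 : distribFun H A < 1) {p : Polynomial ℂ} (hp : p.Monic) :
    Real.exp (-deficit p.natDegree (distribFun H A) A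
      (∫ t in {t | ENNReal.ofReal A < H t}ᶜ, (H t).toReal ∂m)) ≤
      ∫ t, ‖p.eval (t : ℂ)‖ ^ 2 ∂ρ := by
  have hE := measurableSet_superlevel hH A
  have hES {t : Circle} (ht : t ∈ {t | ENNReal.ofReal A < H t}ᶜ) := toReal_le_of_notMem_superlevel hA ht
  have hρint := setIntegral_exp_neg_mul_le hH hρ A p
  set E := {t | ENNReal.ofReal A < H t} with hEdef
  have hε : distribFun H A = m.real E := rfl
  set ε := distribFun H A
  set h := ∫ t in Eᶜ, (H t).toReal ∂m with hh
  have h1ε : 0 < 1 - ε := by linarith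
  have hM0 := remezBound_nonneg (n := p.natDegree) h0 h1 hA
  set M := remezBound p.natDegree ε A with hM
  have hh0 : 0 ≤ h := integral_nonneg fun t ↦ ENNReal.toReal_nonneg
  set B := deficit p.natDegree ε A h with hB
  have hB0 : 0 ≤ B := by rw [hB, deficit]; positivity
  have hBε : (1 - ε) * B = 2 * (ε * M) + h + ε := by
    rw [hB, deficit, ← hM]; field_simp
  set W := ∫ t, ‖p.eval (t : ℂ)‖ ^ 2 ∂ρ with hW
  -- Smallness of `∫ |p|² dρ` is used twice: it is at most `1`, which feeds the Remez bound, and it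
  -- is below `exp (-B)`, which makes the logarithmic mean off `E` too negative.
  by_contra! hlt
  set φ : Circle → ℝ := fun t ↦ Real.log ‖p.eval (t : ℂ)‖ with hφ
  have hφi : Integrable φ m := integrable_log_norm_eval p
  have hq := integrable_norm_eval_sq p m
  have hHi : IntegrableOn (fun t ↦ (H t).toReal) Eᶜ m := by
    refine Measure.integrableOn_of_bounded (M := A) (measure_ne_top _ _)
      hH.ennreal_toReal.aestronglyMeasurable ?_
    refine (ae_restrict_iff' hE.compl).2 (ae_of_all _ fun t ht ↦ ?_)
    rw [Real.norm_of_nonneg ENNReal.toReal_nonneg]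
    exact hES ht
  have hqi : Integrable (fun t ↦ Real.exp (-(H t).toReal) * ‖p.eval (t : ℂ)‖ ^ 2) m := by
    refine hq.bdd_mul (c := 1)
      (Real.measurable_exp.comp hH.ennreal_toReal.neg).aestronglyMeasurable
      (ae_of_all _ fun t ↦ ?_)
    rw [Real.norm_of_nonneg (Real.exp_pos _).le]
    exact Real.exp_le_one_iff.2 (neg_nonpos.2 ENNReal.toReal_nonneg)
  have hint : ∫ t in Eᶜ, ‖p.eval (t : ℂ)‖ ^ 2 ∂m ≤ Real.exp A := by
    calc ∫ t in Eᶜ, ‖p.eval (t : ℂ)‖ ^ 2 ∂m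
        ≤ ∫ t in Eᶜ, Real.exp A * (Real.exp (-(H t).toReal) * ‖p.eval (t : ℂ)‖ ^ 2) ∂m := by
          refine setIntegral_mono_on hq.integrableOn (hqi.const_mul _).integrableOn hE.compl
            fun t ht ↦ ?_
          rw [← mul_assoc, ← Real.exp_add]
          refine le_mul_of_one_le_left (sq_nonneg _) (Real.one_le_exp ?_)
          linarith [hES ht]
      _ = Real.exp A * ∫ t in Eᶜ, Real.exp (-(H t).toReal) * ‖p.eval (t : ℂ)‖ ^ 2 ∂m :=
          integral_const_mul _ _
      _ ≤ Real.exp A * 1 := by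
          refine mul_le_mul_of_nonneg_left (hρint.trans (hlt.le.trans ?_)) (Real.exp_pos A).le
          exact Real.exp_le_one_iff.2 (neg_nonpos.2 hB0)
      _ = Real.exp A := mul_one _
  have hφE : ∫ t in E, φ t ∂m ≤ ε * M := by
    calc ∫ t in E, φ t ∂m ≤ ∫ _ in E, M ∂m :=
          integral_mono hφi.integrableOn (integrable_const _) fun t ↦
            log_norm_eval_le_remezBound hp hE hA h0 h1 hint t
      _ = ε * M := by rw [setIntegral_const, smul_eq_mul, ← hε]
  have hmean : 0 ≤ ∫ t in E, φ t ∂m + ∫ t in Eᶜ, φ t ∂m := by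
    rw [integral_add_compl hE hφi]
    exact integral_log_norm_eval_nonneg hp
  have hc0 := Real.exp_pos (-B)
  -- Tangent to `log` at `exp (-B)`, applied to `e^{-H} |p|²`. By `hBε` the right side equals `-2εM
  -- - h`, contradicting `hmean` and `hφE`.
  have hφF : 2 * (∫ t in Eᶜ, φ t ∂m) - h < 1 + (1 - ε) * (-B - 1) := by
    calc 2 * (∫ t in Eᶜ, φ t ∂m) - h = ∫ t in Eᶜ, (2 * φ t - (H t).toReal) ∂m := by
          rw [integral_sub (hφi.const_mul 2).integrableOn hHi, integral_const_mul]
      _ ≤ ∫ t in Eᶜ, (Real.exp (-(H t).toReal) * ‖p.eval (t : ℂ)‖ ^ 2 * (Real.exp (-B))⁻¹ +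
            (-B - 1)) ∂m := by
          refine integral_mono_ae ((hφi.const_mul 2).integrableOn.sub hHi)
            ((hqi.mul_const _).integrableOn.add (integrable_const _)) ?_
          filter_upwards [ae_restrict_of_ae (ae_eval_ne_zero hp.ne_zero)] with t ht
          have hpt := pow_pos (norm_pos_iff.2 ht) 2
          have := log_le_div_add_log_sub_one (mul_pos (Real.exp_pos (-(H t).toReal)) hpt) hc0
          rw [Real.log_mul (Real.exp_pos _).ne' hpt.ne', Real.log_exp, Real.log_pow,
            Real.log_exp, div_eq_mul_inv] at this
          push_cast at this
          refine le_trans (le_of_eq ?_) this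
          ring
      _ = (∫ t in Eᶜ, Real.exp (-(H t).toReal) * ‖p.eval (t : ℂ)‖ ^ 2 ∂m) *
            (Real.exp (-B))⁻¹ + (1 - ε) * (-B - 1) := by
          rw [integral_add (hqi.mul_const _).integrableOn (integrable_const _),
            integral_mul_const, setIntegral_const, smul_eq_mul, measureReal_compl hE,
            probReal_univ, ← hε]
      _ < 1 + (1 - ε) * (-B - 1) := by
          gcongr
          rw [← div_eq_mul_inv]
          exact (div_lt_one hc0).2 (hρint.trans_lt hlt)
  linarith

theorem bddBelow_range_minNorm (ρ : Measure Circle) (n : ℕ) :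
    BddBelow (range fun q : Fin n → ℂ ↦
      √(∫ t : Circle, ‖(∑ j : Fin n, q j * (t : ℂ) ^ (j : ℕ)) + (t : ℂ) ^ n‖ ^ 2 ∂ρ)) :=
  ⟨0, by rintro _ ⟨q, rfl⟩; exact Real.sqrt_nonneg _⟩

theorem exp_neg_deficit_le_minNorm {ρ : Measure Circle} [IsFiniteMeasure ρ]
    {H : Circle → ℝ≥0∞} (hH : Measurable H) (hρ : expNegMeasure H ≤ ρ) {A : ℝ} (hA : 0 ≤ A)
    (h0 : 0 < distribFun H A) (h1 : distribFun H A < 1) (n : ℕ) :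
    Real.exp (-deficit n (distribFun H A) A
      (∫ t in {t | ENNReal.ofReal A < H t}ᶜ, (H t).toReal ∂m) / 2) ≤ minNorm ρ n := by
  refine le_ciInf fun q ↦ ?_
  set r : Polynomial ℂ := ∑ j : Fin n, Polynomial.C (q j) * Polynomial.X ^ (j : ℕ) with hr
  have hdeg : r.degree < n := by
    refine (Polynomial.degree_sum_le _ _).trans_lt ((Finset.sup_lt_iff (WithBot.bot_lt_coe n)).2
      fun j _ ↦ (Polynomial.degree_C_mul_X_pow_le _ _).trans_lt ?_)
    exact WithBot.coe_lt_coe.2 j.2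
  have hp : (Polynomial.X ^ n + r).Monic := Polynomial.monic_X_pow_add hdeg
  have hn : (Polynomial.X ^ n + r).natDegree = n := Polynomial.natDegree_eq_of_degree_eq_some
    (by rw [Polynomial.degree_add_eq_left_of_degree_lt (by simpa using hdeg),
      Polynomial.degree_X_pow])
  have hev (t : ℂ) : (Polynomial.X ^ n + r).eval t = (∑ j : Fin n, q j * t ^ (j : ℕ)) + t ^ n := by
    simp [hr, Polynomial.eval_finsetSum, add_comm]
  have := exp_neg_deficit_le_integral hH hρ hA h0 h1 hp
  rw [hn] at this
  simp_rw [hev] at this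
  refine Real.le_sqrt_of_sq_le (le_trans (le_of_eq ?_) this)
  rw [← Real.exp_nat_mul]
  congr 1
  push_cast
  ring

theorem minNorm_le (ρ : Measure Circle) (n : ℕ) : minNorm ρ n ≤ √(ρ.real univ) := by
  refine (ciInf_le (bddBelow_range_minNorm ρ n) 0).trans_eq ?_
  have h (t : Circle) : ‖(∑ j : Fin n, (0 : Fin n → ℂ) j * (t : ℂ) ^ (j : ℕ)) + (t : ℂ) ^ n‖ ^ 2
      = 1 := by
    rw [Finset.sum_eq_zero fun j _ ↦ by rw [Pi.zero_apply, zero_mul], zero_add, norm_pow,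
      Circle.norm_coe, one_pow, one_pow]
  simp_rw [h]
  simp

theorem mul_log_inv_le_one {ε : ℝ} (h0 : 0 < ε) : ε * Real.log ε⁻¹ ≤ 1 := by
  have := Real.log_le_sub_one_of_pos (inv_pos.2 h0)
  calc ε * Real.log ε⁻¹ ≤ ε * ε⁻¹ := mul_le_mul_of_nonneg_left (by linarith) h0.le
    _ = 1 := mul_inv_cancel₀ h0.ne'

/-- The equation `nε = A` turns the degree term `nε²` into `Aε ≤ I`; `ε log (1/ε) ≤ 1` and `2 ≤ I`
absorb the rest. -/
theorem deficit_le {n : ℕ} {ε A h I D : ℝ} (h0 : 0 < ε) (h1 : ε < 1) (hD : 1 / (1 - ε) ≤ D)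
    (hA : 0 ≤ A) (hn : n * ε = A) (hAI : A * ε ≤ I) (hh0 : 0 ≤ h) (hhI : h ≤ I) (hI : 2 ≤ I) :
    deficit n ε A h ≤ D * (2 * (2 * D * (4 * D + 1)) + 2) * I := by
  have h1ε : 0 < 1 - ε := by linarith
  have hD0 : 0 < D := (by positivity : 0 < 1 / (1 - ε)).trans_le hD
  have hl := mul_log_inv_le_one h0
  have hM0 := remezBound_nonneg (n := n) h0 h1 hA
  have hM : ε * remezBound n ε A ≤ 2 * D * (4 * D + 1) * I := by
    calc ε * remezBound n ε A = 2 * (1 / (1 - ε)) * (4 * (1 / (1 - ε)) * (n * ε * ε) +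
          (A * ε + ε * Real.log ε⁻¹ + ε) / 2) := by
          rw [remezBound]; ring
      _ = 2 * (1 / (1 - ε)) * (4 * (1 / (1 - ε)) * (A * ε) +
          (A * ε + ε * Real.log ε⁻¹ + ε) / 2) := by rw [hn]
      _ ≤ 2 * D * (4 * D * I + (I + 1 + 1) / 2) := by
          have hlogε : 0 ≤ Real.log ε⁻¹ := Real.log_nonneg ((one_le_inv₀ h0).2 h1.le)
          gcongr
      _ ≤ 2 * D * (4 * D * I + I) := by gcongr; linarith
      _ = 2 * D * (4 * D + 1) * I := by ring
  calc deficit n ε A h = 1 / (1 - ε) * (2 * (ε * remezBound n ε A) + h + ε) := by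
        rw [deficit]; ring
    _ ≤ D * (2 * (2 * D * (4 * D + 1) * I) + I + I) := by
        gcongr
        linarith
    _ = _ := by ring

end SzegoMinimum

theorem mainTheorem2 (κ : ℝ) (hκ : κ < 1) :
    ∃ C : ℝ, 0 < C ∧
      ∀ (ρ : Measure Circle) (H : Circle → ℝ≥0∞),
        IsFiniteMeasure ρ →
        Measurable H →
        ∫⁻ t, H t ∂SzegoMinimum.m = ∞ →
        SzegoMinimum.m.real {t | H t = ∞} ≤ κ →
        SzegoMinimum.expNegMeasure H ≤ ρ →
        ∀ᶠ n : ℕ in atTop,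
          0 < SzegoMinimum.minNorm ρ n ∧
          ∀ A : ℝ, (n : ℝ) * SzegoMinimum.distribFun H A = A →
            |Real.log (SzegoMinimum.minNorm ρ n)| ≤
              C * ∫ a in (0 : ℝ)..A, SzegoMinimum.distribFun H a := by
  have h1κ : 0 < 1 - κ := by linarith
  -- Bounds `1 / (1 - ε)` once `ε ≤ (1 + κ) / 2`, the midpoint of `κ` and `1`.
  set D : ℝ := 2 / (1 - κ) with hD
  have hD0 : 0 < D := by positivity
  set C : ℝ := D * (2 * (2 * D * (4 * D + 1)) + 2) with hC
  have hC0 : 0 < C := by positivity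
  -- The extra `1` pays for the upper bound `log √ρ(𝕋) ≤ I`.
  refine ⟨C + 1, by positivity, fun ρ H _ hH hint hκH hρ ↦ ?_⟩
  have hlt : SzegoMinimum.m.real {t | H t = ∞} < (1 + κ) / 2 := by linarith
  obtain ⟨k, hkε, hkI⟩ :=
    (((SzegoMinimum.tendsto_distribFun hH).eventually (gt_mem_nhds hlt)).and
    ((SzegoMinimum.tendsto_integral_distribFun hH hint).eventually_ge_atTop
      (2 + |Real.log √(ρ.real univ)|))).exists
  have hpos := SzegoMinimum.distribFun_pos hint (k : ℝ)
  have hbig : ∀ᶠ n : ℕ in atTop, (k : ℝ) / SzegoMinimum.distribFun H k < n :=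
    tendsto_natCast_atTop_atTop.eventually_gt_atTop _
  filter_upwards [hbig] with n hn
  have hminpos : 0 < SzegoMinimum.minNorm ρ n :=
    (Real.exp_pos _).trans_le (SzegoMinimum.exp_neg_deficit_le_minNorm hH hρ
      (Nat.cast_nonneg k) hpos (by linarith) n)
  refine ⟨hminpos, fun A hA ↦ ?_⟩
  rw [div_lt_iff₀ hpos] at hn
  -- If `A < k`, then `A = n λ_H(A) ≥ n λ_H(k) > k`. Hence every solution passes the fixed threshold
  -- `k`.
  have hkA : (k : ℝ) ≤ A := by
    by_contra! hlt
    have := mul_le_mul_of_nonneg_left (SzegoMinimum.antitone_distribFun H hlt.le)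
      (Nat.cast_nonneg (α := ℝ) n)
    linarith
  have hA0 : 0 ≤ A := (Nat.cast_nonneg k).trans hkA
  have hε0 := SzegoMinimum.distribFun_pos hint A
  have hεle : SzegoMinimum.distribFun H A ≤ (1 + κ) / 2 :=
    (SzegoMinimum.antitone_distribFun H hkA).trans hkε.le
  have hε1 : SzegoMinimum.distribFun H A < 1 := by linarith
  have hI := hkI.trans (SzegoMinimum.integral_distribFun_mono (Nat.cast_nonneg k) hkA)
  set I := ∫ a in (0 : ℝ)..A, SzegoMinimum.distribFun H a
  have habs := abs_nonneg (Real.log √(ρ.real univ))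
  have hDle : 1 / (1 - SzegoMinimum.distribFun H A) ≤ D := by
    rw [hD, div_le_div_iff₀ (by linarith) h1κ]
    linarith
  have hdef := SzegoMinimum.deficit_le hε0 hε1 hDle hA0 hA
    (SzegoMinimum.mul_distribFun_le hA0) (integral_nonneg fun _ ↦ ENNReal.toReal_nonneg)
    (SzegoMinimum.setIntegral_toReal_le hH hA0) (by linarith)
  have hlow := Real.log_le_log (Real.exp_pos _)
    (SzegoMinimum.exp_neg_deficit_le_minNorm hH hρ hA0 hε0 hε1 n)
  rw [Real.log_exp] at hlow
  have hup := (Real.log_le_log hminpos (SzegoMinimum.minNorm_le ρ n)).trans (le_abs_self _)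
  have hCI : 0 ≤ C * I := mul_nonneg hC0.le (by linarith)
  rw [abs_le]
  constructor <;> linarith
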